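/- For $n\ge 1$ let $\mathcal S_n$ be the set of permutations $\pi=\pi(1)\cdots\pi(n)$ of $\{1,\dots,n\}$, put $\pi(0)=0$, and let $$\mathrm{lpk}(\pi)=\#\{i\in\{1,\dots,n-1\}:\ \pi(i-1)<\pi(i)>\pi(i+1)\}$$ be the number of left peaks of $\pi$. Define $$T_n^E(x)=\sum_{\pi\in\mathcal S_n,\ \pi(n-1)>\pi(n)}x^{\mathrm{lpk}(\pi)},\qquad T_n^O(x)=\sum_{\pi\in\mathcal S_n,\ \pi(n-1)<\pi(n)}x^{\mathrm{lpk}(\pi)}.$$ For real polynomials $p,q$ with only real zeros, $\xi_1\le\cdots\le\xi_n$ those of $p$ and $\theta_1\le\cdots\le\theta_m$ those of $q$ (with multiplicity), write $p\prec q$ if either $m=n+1$ and $\theta_1\le\xi_1\le\theta_2\le\cdots\le\xi_n\le\theta_{n+1}$, or $m=n$ and $\xi_1\le\theta_1\le\xi_2\le\cdots\le\xi_n\le\theta_n$. Then $T_1^E(x)=0$, $T_1^O(x)=1$, and for all $n\ge1$ $$T_{n+1}^E(x)=nx\,T_n^E(x)+2x(1-x)\frac{d}{dx}T_n^E(x)+x\,T_n^O(x),$$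 $$T_{n+1}^O(x)=\bigl((n-1)x+1\bigr)T_n^O(x)+2x(1-x)\frac{d}{dx}T_n^O(x)+T_n^E(x).$$ Moreover, for every $n\ge1$ all complex zeros of $T_n^O$ are real and negative, and for every $n\ge2$ the polynomial $T_n^E$ has a simple zero at $0$, all its other complex zeros are real and negative, and $T_n^O\prec T_n^E$. -/

import Mathlib

open Polynomial

namespace UpDownRun

/-- The one-line word `π(0) π(1) ⋯ π(n)` of a permutation `π` of `[n]`, with the convention
`π(0) = 0`. A permutation of `[n]` is coded as a permutation of `Fin n`, so that positions and
values are shifted by one. The value is `0` beyond position `n` (never used). -/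
def word {n : ℕ} (π : Equiv.Perm (Fin n)) : ℕ → ℕ
  | 0 => 0
  | i + 1 => if h : i < n then (π ⟨i, h⟩ : ℕ) + 1 else 0

/-- The number of left peaks: the `i ∈ [n-1]` with `π(i-1) < π(i) > π(i+1)`, where `π(0) = 0`. -/
def lpk {n : ℕ} (π : Equiv.Perm (Fin n)) : ℕ :=
  ((Finset.Icc 1 (n - 1)).filter
    (fun i => word π (i - 1) < word π i ∧ word π i > word π (i + 1))).card

/-- The permutations of `[n]` whose last step descends, `π(n-1) > π(n)`. -/
def permDesc (n : ℕ) : Finset (Equiv.Perm (Fin n)) :=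
  Finset.univ.filter (fun π => word π (n - 1) > word π n)

/-- The permutations of `[n]` whose last step ascends, `π(n-1) < π(n)`. -/
def permAsc (n : ℕ) : Finset (Equiv.Perm (Fin n)) :=
  Finset.univ.filter (fun π => word π (n - 1) < word π n)

/-- `T_n^E`, the left peak polynomial of the permutations whose last step descends. -/
noncomputable def TE (n : ℕ) : ℝ[X] := ∑ π ∈ permDesc n, X ^ lpk π

/-- `T_n^O`, the left peak polynomial of the permutations whose last step ascends. -/
noncomputable def TO (n : ℕ) : ℝ[X] := ∑ π ∈ permAsc n, X ^ lpk π

/-- `p` is a nonzero polynomial with only real zeros, and `ξ 0 ≤ ⋯ ≤ ξ (n-1)` is the list of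
all its zeros with multiplicity. -/
def HasZeroList (p : ℝ[X]) {n : ℕ} (ξ : Fin n → ℝ) : Prop :=
  p ≠ 0 ∧ Monotone ξ ∧ p = C p.leadingCoeff * ∏ i, (X - C (ξ i))

/-- `p` interlaces `q`: both have only real zeros, `deg q = 1 + deg p`, and
`θ₁ ≤ ξ₁ ≤ θ₂ ≤ ⋯ ≤ ξₙ ≤ θₙ₊₁` for the zeros `ξ` of `p` and `θ` of `q`. -/
def Interlaces (p q : ℝ[X]) : Prop :=
  ∃ (n : ℕ) (ξ : Fin n → ℝ) (θ : Fin (n + 1) → ℝ), HasZeroList p ξ ∧ HasZeroList q θ ∧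
    ∀ i : Fin n, θ i.castSucc ≤ ξ i ∧ ξ i ≤ θ i.succ

/-- `p` alternates left of `q`: both have only real zeros, `deg p = deg q`, and
`ξ₁ ≤ θ₁ ≤ ξ₂ ≤ ⋯ ≤ ξₙ ≤ θₙ` for the zeros `ξ` of `p` and `θ` of `q`. -/
def AlternatesLeft (p q : ℝ[X]) : Prop :=
  ∃ (n : ℕ) (ξ θ : Fin n → ℝ), HasZeroList p ξ ∧ HasZeroList q θ ∧
    (∀ i, ξ i ≤ θ i) ∧ ∀ i j : Fin n, (i : ℕ) + 1 = j → θ i ≤ ξ j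

/-- `p ≺ q`: `p` interlaces `q` or `p` alternates left of `q`. -/
def Prec (p q : ℝ[X]) : Prop := Interlaces p q ∨ AlternatesLeft p q

end UpDownRun

namespace UpDownRun

/-! The recurrences come from inserting the letter `n + 1` into a permutation of `[n]`. In a gap
adjacent to a left peak it takes over that peak. In any other gap before the last letter it creates
a new one, and at the end it changes nothing. A word with `k` left peaks has `2 * k` adjacent gaps,
whence the term `2 * X * (1 - X) * derivative`. The last step of the new word depends only on the
gap and on the old last step.

For the zeros, combine both families into `u n = TE n (x ^ 2) + x * TO n (x ^ 2)`. The two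
recurrences become one: `u (n + 1) = x * ((n * x + 1) * u n + (1 - x ^ 2) * (u n)')`. After a power
of `x + 1` is split off, a Rolle-type sign count shows that the cofactor has simple zeros in `(-1,
0]`, including `0` (`exists_upDownPoly_eq`). So `u n` is a positive constant times `x` and factors
`x + b` with `b > 0`.

A Hermite–Biehler argument then passes to the even and odd parts. Multiplication by `x + b` sends
(odd, even) = `(f, g)` to `(b * f + g, b * g + x * f)`, and this preserves the alternation of `g` at
the zeros of `f` (`HermiteBiehlerPair.mul_X_add_C`). Starting from `u = x`, with the pair `(1, 0)`,
induction over the factors reaches `(TO n, TE n)`. The sign pattern locates the zeros of both parts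
and gives `≺`. -/

/-! ### Left peaks under insertion of a largest letter -/

/-- The indicator of a left peak of the word `w` at position `j`; it vanishes at `j = 0`. -/
def peakInd (w : ℕ → ℕ) (j : ℕ) : ℕ := if w (j - 1) < w j ∧ w (j + 1) < w j then 1 else 0

/-- The word obtained from `w` by inserting the letter `a` right after position `i`. -/
def insertLetter (w : ℕ → ℕ) (i a : ℕ) : ℕ → ℕ :=
  fun j => if j ≤ i then w j else if j = i + 1 then a else w (j - 1)

theorem peakInd_zero (w : ℕ → ℕ) : peakInd w 0 = 0 := by simp [peakInd]

theorem lpk_eq_sum {n : ℕ} (π : Equiv.Perm (Fin n)) :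
    lpk π = ∑ j ∈ Finset.range n, peakInd (word π) j := by
  rcases n with _ | n
  · simp [lpk]
  · rw [Finset.sum_range_succ', peakInd_zero, add_zero, lpk, Finset.card_filter,
      Finset.range_eq_Ico, Finset.sum_Ico_add' (fun j => peakInd (word π) j) 0 n 1]
    rfl

theorem peakInd_congr {w v : ℕ → ℕ} {j k : ℕ} (h1 : w (j - 1) = v (k - 1)) (h2 : w j = v k)
    (h3 : w (j + 1) = v (k + 1)) : peakInd w j = peakInd v k := by
  simp only [peakInd, h1, h2, h3]

theorem sum_peakInd_insertLetter_last (w : ℕ → ℕ) (n a : ℕ) (hw : ∀ j ≤ n, w j < a) :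
    ∑ j ∈ Finset.range (n + 1), peakInd (insertLetter w n a) j
      = ∑ j ∈ Finset.range n, peakInd w j := by
  rw [Finset.sum_range_succ]
  have h1 : peakInd (insertLetter w n a) n = 0 := by
    have := hw n le_rfl
    simp [peakInd, insertLetter]
    omega
  rw [h1, add_zero]
  refine Finset.sum_congr rfl fun j hj => ?_
  have hj := Finset.mem_range.1 hj
  apply peakInd_congr <;> simp only [insertLetter] <;> rw [if_pos (by omega)]

/-- The large letter is itself a peak, and neither neighbour can be one any more; other positions
keep their neighbourhoods. The test `i + 1 < n` excludes the last letter, which never counts as a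
left peak. -/
theorem sum_peakInd_insertLetter (w : ℕ → ℕ) (n i a : ℕ) (hw : ∀ j ≤ n, w j < a) (hi : i < n) :
    ∑ j ∈ Finset.range (n + 1), peakInd (insertLetter w i a) j
        + (peakInd w i + if i + 1 < n then peakInd w (i + 1) else 0)
      = ∑ j ∈ Finset.range n, peakInd w j + 1 := by
  have hA : ∑ j ∈ Finset.range i, peakInd (insertLetter w i a) j
      = ∑ j ∈ Finset.range i, peakInd w j := by
    refine Finset.sum_congr rfl fun j hj => ?_
    have hj := Finset.mem_range.1 hj
    apply peakInd_congr <;> simp only [insertLetter] <;> rw [if_pos (by omega)]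
  have h1 : peakInd (insertLetter w i a) i = 0 := by
    have := hw i hi.le
    simp [peakInd, insertLetter]
    omega
  have h2 : peakInd (insertLetter w i a) (i + 1) = 1 := by
    have := hw i hi.le
    have := hw (i + 1) hi
    simp [peakInd, insertLetter]
    omega
  -- For `d = 0` the letter lands just before the last one, and there is no further position to
  -- compare.
  obtain ⟨d, rfl⟩ : ∃ d, n = i + 1 + d := ⟨n - (i + 1), by omega⟩
  rcases d with _ | e
  · rw [add_zero, Finset.sum_range_succ, Finset.sum_range_succ, Finset.sum_range_succ, hA, h1, h2]
    simp
    omega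
  · have h3 : peakInd (insertLetter w i a) (i + 2) = 0 := by
      have := hw (i + 1) hi
      simp [peakInd, insertLetter]
      omega
    have hB : ∑ j ∈ Finset.range e, peakInd (insertLetter w i a) (i + 3 + j)
        = ∑ j ∈ Finset.range e, peakInd w (i + 2 + j) := by
      refine Finset.sum_congr rfl fun j hj => ?_
      have hj := Finset.mem_range.1 hj
      apply peakInd_congr <;> simp only [insertLetter] <;>
        rw [if_neg (by omega), if_neg (by omega)] <;> congr 1 <;> omega
    have hC : ∀ f : ℕ → ℕ, ∑ j ∈ Finset.range (i + 3 + e), f j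
        = ∑ j ∈ Finset.range i, f j + f i + f (i + 1) + f (i + 2)
          + ∑ j ∈ Finset.range e, f (i + 3 + j) := fun f => by
      rw [Finset.sum_range_add, Finset.sum_range_succ, Finset.sum_range_succ,
        Finset.sum_range_succ]
    have hD : ∀ f : ℕ → ℕ, ∑ j ∈ Finset.range (i + 2 + e), f j
        = ∑ j ∈ Finset.range i, f j + f i + f (i + 1)
          + ∑ j ∈ Finset.range e, f (i + 2 + j) := fun f => by
      rw [Finset.sum_range_add, Finset.sum_range_succ, Finset.sum_range_succ]
    rw [show i + 1 + (e + 1) + 1 = i + 3 + e by omega, show i + 1 + (e + 1) = i + 2 + e by omega,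
      hC, hD, hB, hA, h1, h2, h3, if_pos (by omega)]
    omega

/-- Each peak is met twice, from the gap before it and from the gap after it. -/
theorem sum_adjacent_peakInd (w : ℕ → ℕ) (n : ℕ) :
    ∑ i ∈ Finset.range n, (peakInd w i + if i + 1 < n then peakInd w (i + 1) else 0)
      = 2 * ∑ i ∈ Finset.range n, peakInd w i := by
  rw [Finset.sum_add_distrib, two_mul]
  congr 1
  rcases n with _ | n
  · simp
  · rw [Finset.sum_range_succ, Finset.sum_range_succ', peakInd_zero, if_neg (by omega)]
    refine congrArg (· + 0) (Finset.sum_congr rfl fun j hj => ?_)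
    have hj := Finset.mem_range.1 hj
    rw [if_pos (by omega)]

theorem adjacent_peakInd_le_one (w : ℕ → ℕ) (n i : ℕ) :
    (peakInd w i + if i + 1 < n then peakInd w (i + 1) else 0) ≤ 1 := by
  simp only [peakInd, Nat.add_sub_cancel]
  split_ifs <;> omega

theorem X_pow_sum_peakInd_insertLetter (w : ℕ → ℕ) (n i a : ℕ) (hw : ∀ j ≤ n, w j < a)
    (hi : i < n) :
    (X : ℝ[X]) ^ (∑ j ∈ Finset.range (n + 1), peakInd (insertLetter w i a) j)
      = X ^ (∑ j ∈ Finset.range n, peakInd w j + 1)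
        + ((peakInd w i + if i + 1 < n then peakInd w (i + 1) else 0 : ℕ) : ℝ[X])
          * (X ^ (∑ j ∈ Finset.range n, peakInd w j)
            - X ^ (∑ j ∈ Finset.range n, peakInd w j + 1)) := by
  have h1 := sum_peakInd_insertLetter w n i a hw hi
  have h2 := adjacent_peakInd_le_one w n i
  generalize (peakInd w i + if i + 1 < n then peakInd w (i + 1) else 0) = c at *
  rw [← h1]
  interval_cases c
  · simp
  · have h3 : ∑ j ∈ Finset.range n, peakInd w j
        = ∑ j ∈ Finset.range (n + 1), peakInd (insertLetter w i a) j := by omega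
    rw [h3]
    simp

/-- With `k` peaks, `2 * k` of the `n` gaps keep the exponent and the others raise it by one; the
derivative of `X ^ k` supplies the factor `k`. -/
theorem sum_X_pow_insertLetter (w : ℕ → ℕ) (n a : ℕ) (hw : ∀ j ≤ n, w j < a) :
    ∑ i ∈ Finset.range n,
        (X : ℝ[X]) ^ (∑ j ∈ Finset.range (n + 1), peakInd (insertLetter w i a) j)
      = (n : ℝ[X]) * X * X ^ (∑ j ∈ Finset.range n, peakInd w j)
        + 2 * X * (1 - X) * derivative (X ^ (∑ j ∈ Finset.range n, peakInd w j)) := by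
  rw [Finset.sum_congr rfl fun i hi =>
    X_pow_sum_peakInd_insertLetter w n i a hw (Finset.mem_range.1 hi), Finset.sum_add_distrib,
    ← Finset.sum_mul, ← Nat.cast_sum, sum_adjacent_peakInd]
  generalize ∑ j ∈ Finset.range n, peakInd w j = k
  rw [Finset.sum_const, Finset.card_range, nsmul_eq_mul, derivative_X_pow]
  rcases k with _ | k
  · simp
  · push_cast
    simp only [map_add, map_natCast, map_one]
    ring

/-! ### Insertion of the maximum into a permutation and the recurrences -/

/-- Insert the largest value into a permutation at position `p`. -/
def insertMax {n : ℕ} (p : Fin (n + 1)) (π : Equiv.Perm (Fin n)) : Equiv.Perm (Fin (n + 1)) :=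
  ((finSuccEquiv' p).trans (Equiv.optionCongr π)).trans (finSuccEquiv' (Fin.last n)).symm

theorem insertMax_self {n : ℕ} (p : Fin (n + 1)) (π : Equiv.Perm (Fin n)) :
    insertMax p π p = Fin.last n := by
  simp [insertMax]

theorem insertMax_succAbove {n : ℕ} (p : Fin (n + 1)) (π : Equiv.Perm (Fin n)) (j : Fin n) :
    insertMax p π (p.succAbove j) = (π j).castSucc := by
  simp [insertMax]

theorem insertMax_bijective (n : ℕ) :
    Function.Bijective (fun x : Equiv.Perm (Fin n) × Fin (n + 1) => insertMax x.2 x.1) := by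
  rw [Fintype.bijective_iff_injective_and_card]
  constructor
  · rintro ⟨π, p⟩ ⟨π', p'⟩ h
    simp only at h
    have hp : p = p' := by
      apply (insertMax p π).injective
      rw [insertMax_self, h, insertMax_self]
    subst hp
    have : π = π' := by
      ext j
      have := DFunLike.congr_fun h (p.succAbove j)
      rw [insertMax_succAbove, insertMax_succAbove] at this
      rw [Fin.castSucc_injective _ this]
    rw [this]
  · simp [Fintype.card_perm, Nat.factorial_succ, mul_comm]

theorem word_insertMax {n : ℕ} (p : Fin (n + 1)) (π : Equiv.Perm (Fin n)) :
    word (insertMax p π) = insertLetter (word π) p (n + 1) := by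
  funext j
  rcases j with _ | j
  · simp [word, insertLetter]
  have hp := p.2
  rcases lt_trichotomy j (p : ℕ) with h | h | h
  · have h1 : (⟨j, by omega⟩ : Fin (n + 1)) = p.succAbove ⟨j, by omega⟩ := by
      rw [Fin.succAbove_of_castSucc_lt _ _ (by simpa [Fin.lt_def] using h)]
      rfl
    simp only [word, insertLetter]
    rw [dif_pos (by omega), if_pos (by omega), dif_pos (by omega), h1, insertMax_succAbove]
    rfl
  · subst h
    simp [word, insertLetter, insertMax_self]
    omega
  · obtain ⟨i, rfl⟩ : ∃ i, j = i + 1 := ⟨j - 1, by omega⟩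
    simp only [word, insertLetter]
    rw [if_neg (by omega), if_neg (by omega)]
    simp only [Nat.add_sub_cancel]
    by_cases hi : i < n
    · have h1 : (⟨i + 1, by omega⟩ : Fin (n + 1)) = p.succAbove ⟨i, hi⟩ := by
        rw [Fin.succAbove_of_le_castSucc _ _ (by simp [Fin.le_def]; omega)]
        rfl
      rw [dif_pos (by omega), dif_pos hi, h1, insertMax_succAbove]
      rfl
    · rw [dif_neg (by omega), dif_neg hi]

theorem word_le {n : ℕ} (π : Equiv.Perm (Fin n)) (j : ℕ) : word π j ≤ n := by
  rcases j with _ | j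
  · simp [word]
  · simp only [word]
    split_ifs <;> omega

theorem word_pred_ne {n : ℕ} (hn : 1 ≤ n) (π : Equiv.Perm (Fin n)) :
    word π (n - 1) ≠ word π n := by
  obtain ⟨m, rfl⟩ : ∃ m, n = m + 1 := ⟨n - 1, by omega⟩
  rcases m with _ | m
  · simp [word]
  · simp only [Nat.add_sub_cancel, word]
    rw [dif_pos (by omega), dif_pos (by omega)]
    intro h
    have h2 : (⟨m, by omega⟩ : Fin (m + 1 + 1)) = ⟨m + 1, by omega⟩ :=
      π.injective (Fin.ext (by omega))
    simp at h2

theorem sum_perm_succ {n : ℕ} (P : (ℕ → ℕ) → Prop) [DecidablePred P] :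
    ∑ σ ∈ Finset.univ.filter (fun σ : Equiv.Perm (Fin (n + 1)) => P (word σ)), (X : ℝ[X]) ^ lpk σ
      = ∑ π : Equiv.Perm (Fin n), ∑ i ∈ Finset.range (n + 1),
          if P (insertLetter (word π) i (n + 1)) then
            X ^ (∑ j ∈ Finset.range (n + 1), peakInd (insertLetter (word π) i (n + 1)) j)
          else 0 := by
  rw [Finset.sum_filter, ← (insertMax_bijective n).sum_comp, Fintype.sum_prod_type]
  refine Finset.sum_congr rfl fun π _ => ?_
  rw [← Fin.sum_univ_eq_sum_range (fun i => if P (insertLetter (word π) i (n + 1)) then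
            (X : ℝ[X]) ^ (∑ j ∈ Finset.range (n + 1), peakInd (insertLetter (word π) i (n + 1)) j)
          else 0) (n + 1)]
  refine Finset.sum_congr rfl fun p _ => ?_
  simp only [lpk_eq_sum, word_insertMax]

/-- After a final descent every gap but the last leaves a final descent. After a final ascent only
the gap just before the last letter produces one, and it creates a new peak. -/
theorem sum_desc_insertLetter {n : ℕ} (hn : 1 ≤ n) (π : Equiv.Perm (Fin n)) :
    (∑ i ∈ Finset.range (n + 1),
      if insertLetter (word π) i (n + 1) n > insertLetter (word π) i (n + 1) (n + 1) then
        (X : ℝ[X]) ^ (∑ j ∈ Finset.range (n + 1), peakInd (insertLetter (word π) i (n + 1)) j)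
      else 0)
    = if word π (n - 1) > word π n then
        (n : ℝ[X]) * X * X ^ lpk π + 2 * X * (1 - X) * derivative (X ^ lpk π)
      else X * X ^ lpk π := by
  have hw : ∀ j ≤ n, word π j < n + 1 := fun j _ => Nat.lt_succ_of_le (word_le π j)
  obtain ⟨m, rfl⟩ : ∃ m, n = m + 1 := ⟨n - 1, by omega⟩
  rw [Finset.sum_range_succ, if_neg, add_zero, lpk_eq_sum]
  swap
  · have := hw (m + 1) le_rfl
    simp [insertLetter]
    omega
  split_ifs with h
  · rw [← sum_X_pow_insertLetter (word π) (m + 1) (m + 1 + 1) hw]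
    refine Finset.sum_congr rfl fun i hi => if_pos ?_
    have hi := Finset.mem_range.1 hi
    have := hw (m + 1) le_rfl
    simp only [insertLetter]
    split_ifs <;> simp at * <;> omega
  · rw [Finset.sum_range_succ, Finset.sum_eq_zero, zero_add, if_pos]
    · rw [X_pow_sum_peakInd_insertLetter (word π) (m + 1) m _ hw (by omega), if_neg (by omega)]
      have : peakInd (word π) m = 0 := by
        have := word_pred_ne hn π
        simp only [Nat.add_sub_cancel] at this h
        rw [peakInd, if_neg (by omega)]
      rw [this, pow_succ']
      simp
    · have := hw (m + 1) le_rfl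
      simp [insertLetter]
      omega
    · intro i hi
      have hi := Finset.mem_range.1 hi
      refine if_neg ?_
      simp only [insertLetter]
      split_ifs <;> simp at * <;> omega

/-- After a final descent only appending the maximum gives an ascent. After a final ascent every gap
works except the one before the last letter; removing its term `X * X ^ lpk π` and adding `X ^ lpk
π` for the end accounts for the coefficient `(n - 1) * X + 1`. -/
theorem sum_asc_insertLetter {n : ℕ} (hn : 1 ≤ n) (π : Equiv.Perm (Fin n)) :
    (∑ i ∈ Finset.range (n + 1),
      if insertLetter (word π) i (n + 1) n < insertLetter (word π) i (n + 1) (n + 1) then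
        (X : ℝ[X]) ^ (∑ j ∈ Finset.range (n + 1), peakInd (insertLetter (word π) i (n + 1)) j)
      else 0)
    = if word π (n - 1) < word π n then
        (((n : ℝ[X]) - 1) * X + 1) * X ^ lpk π + 2 * X * (1 - X) * derivative (X ^ lpk π)
      else X ^ lpk π := by
  have hw : ∀ j ≤ n, word π j < n + 1 := fun j _ => Nat.lt_succ_of_le (word_le π j)
  have hne := word_pred_ne hn π
  obtain ⟨m, rfl⟩ : ∃ m, n = m + 1 := ⟨n - 1, by omega⟩
  rw [Finset.sum_range_succ, if_pos, sum_peakInd_insertLetter_last _ _ _ hw, lpk_eq_sum]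
  swap
  · have := hw (m + 1) le_rfl
    simp [insertLetter]
    omega
  simp only [Nat.add_sub_cancel] at *
  split_ifs with h
  · have h0 := sum_X_pow_insertLetter (word π) (m + 1) (m + 1 + 1) hw
    rw [Finset.sum_range_succ, X_pow_sum_peakInd_insertLetter (word π) (m + 1) m _ hw (by omega),
      if_neg (by omega)] at h0
    have : peakInd (word π) m = 0 := by rw [peakInd, if_neg (by omega)]
    rw [this] at h0
    rw [Finset.sum_range_succ, if_neg, add_zero]
    · rw [Finset.sum_congr rfl (g := fun i => (X : ℝ[X]) ^
        (∑ j ∈ Finset.range (m + 1 + 1), peakInd (insertLetter (word π) i (m + 1 + 1)) j))]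
      · rw [pow_succ'] at h0
        push_cast at h0 ⊢
        linear_combination h0
      · intro i hi
        have hi := Finset.mem_range.1 hi
        refine if_pos ?_
        simp only [insertLetter]
        split_ifs <;> simp at * <;> omega
    · have := hw (m + 1) le_rfl
      simp [insertLetter]
      omega
  · rw [Finset.sum_eq_zero, zero_add]
    intro i hi
    have hi := Finset.mem_range.1 hi
    have := hw (m + 1) le_rfl
    refine if_neg ?_
    simp only [insertLetter]
    split_ifs <;> simp at * <;> omega

theorem permAsc_eq_filter_not {n : ℕ} (hn : 1 ≤ n) :
    permAsc n = Finset.univ.filter (fun π => ¬ word π (n - 1) > word π n) := by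
  ext π
  have := word_pred_ne hn π
  simp only [permAsc, Finset.mem_filter, Finset.mem_univ, true_and]
  omega

theorem permDesc_eq_filter_not {n : ℕ} (hn : 1 ≤ n) :
    permDesc n = Finset.univ.filter (fun π => ¬ word π (n - 1) < word π n) := by
  ext π
  have := word_pred_ne hn π
  simp only [permDesc, Finset.mem_filter, Finset.mem_univ, true_and]
  omega

theorem TE_succ {n : ℕ} (hn : 1 ≤ n) :
    TE (n + 1) = (n : ℝ[X]) * X * TE n + 2 * X * (1 - X) * derivative (TE n) + X * TO n := by
  have h := sum_perm_succ (n := n) (fun w => w n > w (n + 1))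
  rw [TE, permDesc]
  simp only [Nat.add_sub_cancel]
  rw [h, Finset.sum_congr rfl fun π _ => sum_desc_insertLetter hn π, Finset.sum_ite,
    TO, permAsc_eq_filter_not hn, TE, permDesc, Finset.sum_add_distrib, derivative_sum,
    Finset.mul_sum, Finset.mul_sum, Finset.mul_sum]

theorem TO_succ {n : ℕ} (hn : 1 ≤ n) :
    TO (n + 1) = (((n : ℝ[X]) - 1) * X + 1) * TO n + 2 * X * (1 - X) * derivative (TO n)
      + TE n := by
  have h := sum_perm_succ (n := n) (fun w => w n < w (n + 1))
  rw [TO, permAsc]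
  simp only [Nat.add_sub_cancel]
  rw [h, Finset.sum_congr rfl fun π _ => sum_asc_insertLetter hn π, Finset.sum_ite,
    TE, permDesc_eq_filter_not hn, TO, permAsc, Finset.sum_add_distrib, derivative_sum,
    Finset.mul_sum, Finset.mul_sum]

theorem TE_one : TE 1 = 0 := by
  rw [TE, permDesc, Finset.filter_false_of_mem, Finset.sum_empty]
  intro π _
  simp [word]

theorem TO_one : TO 1 = 1 := by
  rw [TO, permAsc, Finset.filter_true_of_mem]
  · simp [lpk]
  · intro π _
    simp [word]

/-! ### Signs of products of linear factors and location of zeros -/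

/-- Exactly the `k - i` zeros to the right of `x` contribute negative factors, and `k - i` has the
parity of `k + i`. -/
theorem neg_one_pow_mul_prod_pos (r : ℕ → ℝ) (x : ℝ) {i k : ℕ} (hik : i ≤ k)
    (h1 : ∀ j < i, r j < x) (h2 : ∀ j, i ≤ j → j < k → x < r j) :
    0 < (-1) ^ (k + i) * (∏ j ∈ Finset.range k, (X - C (r j))).eval x := by
  induction k, hik using Nat.le_induction with
  | base =>
    rw [← two_mul, pow_mul, neg_one_sq, one_pow, one_mul, eval_prod]
    refine Finset.prod_pos fun j hj => ?_
    have := h1 j (Finset.mem_range.1 hj)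
    simp only [eval_sub, eval_X, eval_C]
    linarith
  | succ k hk ih =>
    have h := ih fun j hj hj' => h2 j hj (by omega)
    have h3 := h2 k hk (by omega)
    rw [Finset.prod_range_succ, eval_mul, show k + 1 + i = k + i + 1 by omega, pow_succ]
    simp only [eval_sub, eval_X, eval_C]
    nlinarith [mul_pos h (sub_pos.2 h3)]

theorem lt_of_step_lt {r : ℕ → ℝ} {k : ℕ} (h : ∀ i, i + 1 < k → r i < r (i + 1)) {i j : ℕ}
    (hij : i < j) (hj : j < k) : r i < r j := by
  induction j, hij using Nat.le_induction with
  | base => exact h i hj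
  | succ j hj' ih => exact (ih (by omega)).trans (h j hj)

/-- The derivative at a simple zero is the product of the differences to the other zeros, of which
`k - 1 - i` are negative. -/
theorem neg_one_pow_mul_derivative_prod_pos (r : ℕ → ℝ) {i k : ℕ} (hik : i < k)
    (hr : ∀ i, i + 1 < k → r i < r (i + 1)) :
    0 < (-1) ^ (k + i + 1) * (derivative (∏ j ∈ Finset.range k, (X - C (r j)))).eval (r i) := by
  induction k, hik using Nat.le_induction with
  | base =>
    have h := neg_one_pow_mul_prod_pos r (r i) le_rfl
      (fun j hj => lt_of_step_lt hr hj (by omega)) (by intros; omega)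
    rw [Finset.prod_range_succ, derivative_mul, derivative_X_sub_C,
      show i.succ + i + 1 = i + i + 2 by omega, pow_add]
    simpa using h
  | succ k hk ih =>
    have h := ih fun j hj => hr j (by omega)
    have h3 : r i < r k := lt_of_step_lt hr hk (by omega)
    have h4 : (∏ j ∈ Finset.range k, (X - C (r j))).eval (r i) = 0 := by
      rw [eval_prod]
      exact Finset.prod_eq_zero (Finset.mem_range.2 hk) (by simp)
    rw [Finset.prod_range_succ, derivative_mul, derivative_X_sub_C,
      show k + 1 + i + 1 = k + i + 1 + 1 by omega, pow_succ]
    simp only [eval_add, eval_mul, eval_sub, eval_X, eval_C, h4]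
    nlinarith [mul_pos h (sub_pos.2 h3)]

theorem exists_root_of_mul_neg (q : ℝ[X]) {a b : ℝ} (hab : a < b)
    (h : q.eval a * q.eval b < 0) : ∃ x, a < x ∧ x < b ∧ q.eval x = 0 := by
  rcases mul_neg_iff.1 h with ⟨h1, h2⟩ | ⟨h1, h2⟩
  · obtain ⟨x, hx, hx'⟩ := intermediate_value_Ioo' hab.le q.continuous.continuousOn ⟨h2, h1⟩
    exact ⟨x, hx.1, hx.2, hx'⟩
  · obtain ⟨x, hx, hx'⟩ := intermediate_value_Ioo hab.le q.continuous.continuousOn ⟨h1, h2⟩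
    exact ⟨x, hx.1, hx.2, hx'⟩

/-- A polynomial of degree at most `k` whose values at `k + 1` increasing points alternate in sign
has exactly `k` zeros, one strictly between any two consecutive points. -/
theorem exists_prod_of_alternating (q : ℝ[X]) (k : ℕ) (hdeg : q.natDegree ≤ k) (t : ℕ → ℝ)
    (ht : ∀ i < k, t i < t (i + 1)) (s : ℝ) (hs : ∀ i ≤ k, 0 < s * (-1) ^ i * q.eval (t i)) :
    ∃ r : ℕ → ℝ, (∀ i < k, t i < r i ∧ r i < t (i + 1)) ∧
      (∀ i, i + 1 < k → r i < r (i + 1)) ∧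
      q.leadingCoeff ≠ 0 ∧
      q = C q.leadingCoeff * ∏ i ∈ Finset.range k, (X - C (r i)) := by
  have hq : q ≠ 0 := by
    rintro rfl
    simpa using hs 0 (Nat.zero_le _)
  have hex : ∀ i, ∃ x, i < k → t i < x ∧ x < t (i + 1) ∧ q.eval x = 0 := by
    intro i
    by_cases hi : i < k
    · obtain ⟨x, hx⟩ := exists_root_of_mul_neg q (ht i hi) (by
        have h1 := hs i hi.le
        have h2 := hs (i + 1) hi
        have h3 := mul_pos h1 h2
        have h4 : ((-1 : ℝ) ^ i) ^ 2 = 1 := by rw [← pow_mul, mul_comm, pow_mul]; simp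
        have h5 : s * (-1) ^ i * q.eval (t i) * (s * (-1) ^ (i + 1) * q.eval (t (i + 1)))
          = -(s ^ 2 * (q.eval (t i) * q.eval (t (i + 1)))) := by
            rw [pow_succ]
            linear_combination (-(s ^ 2 * (q.eval (t i) * q.eval (t (i + 1))))) * h4
        rw [h5] at h3
        by_contra hcon
        nlinarith [mul_nonneg (sq_nonneg s) (not_lt.1 hcon)])
      exact ⟨x, fun _ => hx⟩
    · exact ⟨0, fun h => absurd h hi⟩
  choose r hr using hex
  have hstep : ∀ i, i + 1 < k → r i < r (i + 1) := fun i hi =>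
    (hr i (by omega)).2.1.trans (hr (i + 1) hi).1
  refine ⟨r, fun i hi => ⟨(hr i hi).1, (hr i hi).2.1⟩, hstep, leadingCoeff_ne_zero.2 hq, ?_⟩
  have hdvd : ∏ i ∈ Finset.range k, (X - C (r i)) ∣ q := by
    refine Finset.prod_dvd_of_coprime ?_ fun i hi => ?_
    · intro i hi j hj hij
      refine isCoprime_X_sub_C_of_isUnit_sub (sub_ne_zero.2 ?_).isUnit
      simp only [Finset.coe_range, Set.mem_Iio] at hi hj
      rcases lt_or_gt_of_ne hij with h | h
      · exact (lt_of_step_lt hstep h hj).ne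
      · exact (lt_of_step_lt hstep h hi).ne'
    · exact dvd_iff_isRoot.2 (hr i (Finset.mem_range.1 hi)).2.2
  have hmonic : (∏ i ∈ Finset.range k, (X - C (r i))).Monic :=
    monic_prod_of_monic _ _ fun i _ => monic_X_sub_C (r i)
  refine (eq_leadingCoeff_mul_of_monic_of_dvd_of_natDegree_le hmonic hdvd ?_)
  rwa [natDegree_prod_of_monic _ _ fun i _ => monic_X_sub_C (r i), Finset.sum_congr rfl
    fun i _ => natDegree_X_sub_C (r i), Finset.sum_const, Finset.card_range, smul_eq_mul, mul_one]

/-- Far to the left a polynomial with positive leading coefficient has the sign `(-1) ^ degree`. -/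
theorem exists_lt_neg_one_pow_mul_eval_pos (q : ℝ[X]) (hd : 0 < q.natDegree)
    (hl : 0 < q.leadingCoeff) (y : ℝ) :
    ∃ x < y, 0 < (-1) ^ q.natDegree * q.eval x := by
  have hX : (-X : ℝ[X]).natDegree = 1 := by simp
  -- Reflection turns behaviour at `-∞` into behaviour at `+∞`; the sign makes the leading
  -- coefficient positive again.
  set Q : ℝ[X] := C ((-1) ^ q.natDegree) * q.comp (-X) with hQ
  have hne : ((-1 : ℝ) ^ q.natDegree) ≠ 0 := pow_ne_zero _ (by norm_num)
  have hdeg : Q.natDegree = q.natDegree := by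
    rw [hQ, natDegree_C_mul hne, natDegree_comp, hX, mul_one]
  have hlead : Q.leadingCoeff = q.leadingCoeff := by
    rw [hQ, leadingCoeff_mul, leadingCoeff_C, leadingCoeff_comp (by rw [hX]; norm_num),
      leadingCoeff_neg, leadingCoeff_X, mul_comm, mul_assoc, ← mul_pow]
    simp
  have htend := Q.tendsto_atTop_of_leadingCoeff_nonneg
    (natDegree_pos_iff_degree_pos.1 (by rw [hdeg]; exact hd)) (by rw [hlead]; exact hl.le)
  obtain ⟨x, hx1, hx2⟩ :=
    ((htend.eventually_gt_atTop 0).and (Filter.eventually_gt_atTop (-y))).exists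
  refine ⟨-x, by linarith, ?_⟩
  simpa [hQ, eval_comp] using hx1

theorem monic_prod_X_sub_C (r : ℕ → ℝ) (k : ℕ) :
    (∏ i ∈ Finset.range k, (X - C (r i))).Monic :=
  monic_prod_of_monic _ _ fun i _ => monic_X_sub_C (r i)

theorem natDegree_prod_range_X_sub_C (r : ℕ → ℝ) (k : ℕ) :
    (∏ i ∈ Finset.range k, (X - C (r i))).natDegree = k := by
  rw [natDegree_prod_of_monic _ _ fun i _ => monic_X_sub_C (r i), Finset.sum_congr rfl
    fun i _ => natDegree_X_sub_C (r i), Finset.sum_const, Finset.card_range, smul_eq_mul, mul_one]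

theorem eval_prod_range_X_sub_C_eq_zero (r : ℕ → ℝ) {i k : ℕ} (hi : i < k) :
    (∏ j ∈ Finset.range k, (X - C (r j))).eval (r i) = 0 := by
  rw [eval_prod]
  exact Finset.prod_eq_zero (Finset.mem_range.2 hi) (by simp)

/-! ### Differential operators preserving simple zeros in `(-1, 0]` -/

/-- `p` has degree `k + 1` and simple zeros in `(-1, 0]`, the largest of which is `0`. -/
def SimpleZerosUpToZero (k : ℕ) (p : ℝ[X]) : Prop :=
  ∃ (c : ℝ) (r : ℕ → ℝ), c ≠ 0 ∧ (∀ i, i + 1 < k + 1 → r i < r (i + 1)) ∧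
    (∀ i < k + 1, -1 < r i) ∧ r k = 0 ∧ p = C c * ∏ i ∈ Finset.range (k + 1), (X - C (r i))

theorem SimpleZerosUpToZero.le_zero {k : ℕ} {r : ℕ → ℝ}
    (hr : ∀ i, i + 1 < k + 1 → r i < r (i + 1)) (h0 : r k = 0) {i : ℕ} (hi : i < k + 1) :
    r i ≤ 0 := by
  rcases Nat.lt_succ_iff_lt_or_eq.1 hi with h | rfl
  · exact h0 ▸ (lt_of_step_lt hr h (Nat.lt_succ_self k)).le
  · exact h0.le

theorem simpleZerosUpToZero_X_mul {k : ℕ} {c : ℝ} (hc : c ≠ 0) {s : ℕ → ℝ}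
    (hs : ∀ i, i + 1 < k → s i < s (i + 1)) (hs1 : ∀ i < k, -1 < s i) (hs0 : ∀ i < k, s i < 0)
    {p : ℝ[X]} (hp : p = C c * ∏ i ∈ Finset.range k, (X - C (s i))) :
    SimpleZerosUpToZero k (X * p) := by
  refine ⟨c, fun i => if i < k then s i else 0, hc, ?_, ?_, by simp, ?_⟩
  · intro i hi
    have hik : i < k := by omega
    by_cases h : i + 1 < k
    · simpa [h, hik] using hs i h
    · simpa [h, hik] using hs0 i hik
  · intro i _
    by_cases h : i < k
    · simpa [h] using hs1 i h
    · simp [h]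
  · rw [Finset.prod_range_succ, hp]
    simp only [lt_irrefl, if_false, map_zero, sub_zero]
    rw [Finset.prod_congr rfl (f := fun i => X - C (if i < k then s i else 0))
      (g := fun i => X - C (s i))]
    · ring
    · intro i hi
      simp only [if_pos (Finset.mem_range.1 hi)]

/-- The terms of degree `k + 1` cancel in the bracket. At a zero `r` of `p` the bracket equals `(1 -
r) * p'(r)`, which alternates in sign, so its `k` zeros separate those of `p`; the factor `X`
restores the zero at `0`. -/
theorem simpleZerosUpToZero_one_sub {k : ℕ} {p : ℝ[X]} (hp : SimpleZerosUpToZero k p) :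
    SimpleZerosUpToZero k (X * (((k : ℝ[X]) + 1) * p + (1 - X) * derivative p)) := by
  obtain ⟨c, r, hc, hr, hr1, hr0, rfl⟩ := hp
  set P := ∏ i ∈ Finset.range (k + 1), (X - C (r i)) with hP
  set B := ((k : ℝ[X]) + 1) * (C c * P) + (1 - X) * derivative (C c * P) with hB
  have hPdeg : (C c * P).natDegree = k + 1 := by
    rw [natDegree_C_mul hc, natDegree_prod_range_X_sub_C]
  have hdeg : B.natDegree ≤ k := by
    rw [natDegree_le_iff_coeff_eq_zero]
    intro N hN
    obtain ⟨N, rfl⟩ : ∃ M, N = M + 1 := ⟨N - 1, by omega⟩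
    have hz : (C c * P).coeff (N + 1 + 1) = 0 :=
      coeff_eq_zero_of_natDegree_lt (by omega)
    have hB' : B = C ((k : ℝ) + 1) * (C c * P) + derivative (C c * P)
        - X * derivative (C c * P) := by
      rw [hB]; simp only [map_add, map_natCast, map_one]; ring
    rw [hB', coeff_sub, coeff_add, coeff_C_mul, coeff_X_mul, coeff_derivative, coeff_derivative, hz]
    rcases (show k ≤ N by omega).eq_or_lt with rfl | h
    · ring
    · rw [coeff_eq_zero_of_natDegree_lt (by omega)]
      ring
  have hev : ∀ i < k + 1, 0 < c * (-1) ^ k * (-1) ^ i * B.eval (r i) := by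
    intro i hi
    have h1 := neg_one_pow_mul_derivative_prod_pos r hi hr
    have h2 := SimpleZerosUpToZero.le_zero hr hr0 hi
    rw [← hP] at h1
    have h3 : B.eval (r i) = (1 - r i) * (c * (derivative P).eval (r i)) := by
      simp [hB, hP, eval_prod_range_X_sub_C_eq_zero r hi]
    rw [h3]
    have h4 : 0 < c ^ 2 := by positivity
    have h5 : 0 < 1 - r i := by linarith
    refine (mul_pos (mul_pos h4 h5) h1).trans_eq ?_
    rw [show k + 1 + i + 1 = k + i + 2 by omega, pow_add, pow_add]
    ring
  obtain ⟨s, hs, hss, hlc, hBe⟩ := exists_prod_of_alternating B k hdeg r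
    (fun i hi => hr i (by omega)) (c * (-1) ^ k) (fun i hi => hev i (by omega))
  refine simpleZerosUpToZero_X_mul hlc hss (fun i hi => ?_) (fun i hi => ?_) hBe
  · exact (hr1 i (by omega)).trans (hs i hi).1
  · exact (hs i hi).2.trans_le (SimpleZerosUpToZero.le_zero hr hr0 (by omega))

/-- The terms of degree `k + 2` cancel. At a zero `r` of `p` the bracket is `(1 - r ^ 2) * p'(r)`,
and at `-1` it is `p(-1)`; the added point `-1` gives one more zero, between `-1` and the least zero
of `p`. -/
theorem simpleZerosUpToZero_one_sub_sq {k : ℕ} {p : ℝ[X]} (hp : SimpleZerosUpToZero k p) :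
    SimpleZerosUpToZero (k + 1)
      (X * ((((k : ℝ[X]) + 1) * X + ((k : ℝ[X]) + 2)) * p + (1 - X ^ 2) * derivative p)) := by
  obtain ⟨c, r, hc, hr, hr1, hr0, rfl⟩ := hp
  set P := ∏ i ∈ Finset.range (k + 1), (X - C (r i)) with hP
  set B := (((k : ℝ[X]) + 1) * X + ((k : ℝ[X]) + 2)) * (C c * P) + (1 - X ^ 2) * derivative (C c * P)
    with hB
  have hPdeg : (C c * P).natDegree = k + 1 := by
    rw [natDegree_C_mul hc, natDegree_prod_range_X_sub_C]
  have hdeg : B.natDegree ≤ k + 1 := by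
    rw [natDegree_le_iff_coeff_eq_zero]
    intro N hN
    obtain ⟨N, rfl⟩ : ∃ M, N = M + 2 := ⟨N - 2, by omega⟩
    have hz : ∀ M, k + 1 < M → (C c * P).coeff M = 0 := fun M hM =>
      coeff_eq_zero_of_natDegree_lt (by omega)
    have hB' : B = C ((k : ℝ) + 1) * (X * (C c * P)) + C ((k : ℝ) + 2) * (C c * P)
        + derivative (C c * P) - X * (X * derivative (C c * P)) := by
      rw [hB]; simp only [map_add, map_natCast, map_one, map_ofNat]; ring
    rw [hB', coeff_sub, coeff_add, coeff_add, coeff_C_mul, coeff_C_mul, coeff_X_mul, coeff_X_mul,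
      coeff_X_mul, coeff_derivative, coeff_derivative, hz (N + 2 + 1) (by omega),
      hz (N + 2) (by omega)]
    rcases (show k ≤ N by omega).eq_or_lt with rfl | h
    · ring
    · rw [hz (N + 1) (by omega)]
      ring
  have hev : ∀ i < k + 1, 0 < c * (-1) ^ (k + 1) * (-1) ^ (i + 1) * B.eval (r i) := by
    intro i hi
    have h1 := neg_one_pow_mul_derivative_prod_pos r hi hr
    have h2 := SimpleZerosUpToZero.le_zero hr hr0 hi
    have h2' := hr1 i hi
    rw [← hP] at h1
    have h3 : B.eval (r i) = (1 - r i ^ 2) * (c * (derivative P).eval (r i)) := by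
      simp [hB, hP, eval_prod_range_X_sub_C_eq_zero r hi]
    rw [h3]
    have h4 : 0 < c ^ 2 := by positivity
    have h5 : 0 < 1 - r i ^ 2 := by nlinarith
    refine (mul_pos (mul_pos h4 h5) h1).trans_eq ?_
    rw [show k + 1 + i + 1 = k + 1 + (i + 1) by omega, pow_add]
    ring
  have hev0 : 0 < c * (-1) ^ (k + 1) * B.eval (-1) := by
    have h1 := neg_one_pow_mul_prod_pos r (-1) (Nat.zero_le (k + 1)) (by simp)
      (fun j _ hj => hr1 j hj)
    rw [← hP, add_zero] at h1
    have h3 : B.eval (-1) = c * P.eval (-1) := by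
      simp [hB]
      ring
    rw [h3]
    have h4 : 0 < c ^ 2 := by positivity
    refine (mul_pos h4 h1).trans_eq ?_
    ring
  obtain ⟨s, hs, hss, hlc, hBe⟩ := exists_prod_of_alternating B (k + 1) hdeg
    (fun i => Nat.casesOn i (-1) r)
    (fun i hi => by
      rcases i with _ | i
      · exact hr1 0 (by omega)
      · exact hr i (by omega)) (c * (-1) ^ (k + 1))
    (fun i hi => by
      rcases i with _ | i
      · simpa using hev0
      · exact hev i (by omega))
  refine simpleZerosUpToZero_X_mul hlc hss (fun i hi => ?_) (fun i hi => ?_) hBe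
  · rcases i with _ | i
    · exact (hs 0 hi).1
    · exact (hr1 i (by omega)).trans (hs (i + 1) hi).1
  · exact (hs i hi).2.trans_le (SimpleZerosUpToZero.le_zero hr hr0 (by omega))

/-! ### Hermite–Biehler pairs and multiplication by `X + b` -/

/-- The even and odd parts of a polynomial with a simple zero at `0` and otherwise negative zeros:
`f` has `m` simple negative zeros, `g` alternates in sign at them, `g` vanishes at `0`, and
`g` has degree at most `m + 1`. -/
def HermiteBiehlerPair (m : ℕ) (f g : ℝ[X]) : Prop :=
  ∃ (a : ℝ) (ξ : ℕ → ℝ), 0 < a ∧ (∀ i, i + 1 < m → ξ i < ξ (i + 1)) ∧ (∀ i < m, ξ i < 0) ∧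
    f = C a * ∏ i ∈ Finset.range m, (X - C (ξ i)) ∧
    (∀ i < m, 0 < (-1) ^ (m + i) * g.eval (ξ i)) ∧ g.eval 0 = 0 ∧
    (g.natDegree ≤ m ∨ (g.natDegree = m + 1 ∧ 0 < g.leadingCoeff))

theorem eval_prod_pos_of_lt (r : ℕ → ℝ) (x : ℝ) {k : ℕ} (h : ∀ j < k, r j < x) :
    0 < (∏ j ∈ Finset.range k, (X - C (r j))).eval x := by
  have h1 := neg_one_pow_mul_prod_pos r x le_rfl h (by intros; omega)
  rwa [← two_mul, pow_mul, neg_one_sq, one_pow, one_mul] at h1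

/-- The finite sequence `ξ 0, …, ξ (m - 1)` continued by the constant `b`. -/
def extendBy (ξ : ℕ → ℝ) (m : ℕ) (b : ℝ) (i : ℕ) : ℝ := if i < m then ξ i else b

theorem extendBy_of_lt {ξ : ℕ → ℝ} {m i : ℕ} {b : ℝ} (h : i < m) : extendBy ξ m b i = ξ i :=
  if_pos h

theorem extendBy_self {ξ : ℕ → ℝ} {m : ℕ} {b : ℝ} : extendBy ξ m b m = b := by simp [extendBy]

theorem extendBy_step {ξ : ℕ → ℝ} {m : ℕ} {b : ℝ} (hξ : ∀ i, i + 1 < m → ξ i < ξ (i + 1))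
    (hb : ∀ i < m, ξ i < b) {i : ℕ} (hi : i < m) :
    extendBy ξ m b i < extendBy ξ m b (i + 1) := by
  rw [extendBy_of_lt hi]
  rcases (show i + 1 ≤ m from hi).eq_or_lt with h | h
  · rw [h, extendBy_self]
    exact hb i hi
  · rw [extendBy_of_lt h]
    exact hξ i h

/-- Alternation of the new pair at the zeros of the new odd part. -/
theorem neg_one_pow_mul_eval_pos_of_eval_eq_zero {m l : ℕ} (hl : l ≤ m) {f g : ℝ[X]} {a b : ℝ}
    (ha : 0 < a) {ξ : ℕ → ℝ} (hf : f = C a * ∏ i ∈ Finset.range m, (X - C (ξ i))) {z : ℝ}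
    (hz : z < 0) (hF : (C b * f + g).eval z = 0) (h1 : ∀ j < l, ξ j < z)
    (h2 : ∀ j, l ≤ j → j < m → z < ξ j) :
    0 < (-1) ^ (m + l + 1) * (C b * g + X * f).eval z := by
  have h3 := neg_one_pow_mul_prod_pos ξ z hl h1 h2
  have h4 : f.eval z = a * (∏ i ∈ Finset.range m, (X - C (ξ i))).eval z := by simp [hf]
  simp only [eval_add, eval_mul, eval_C, eval_X] at hF ⊢
  -- At a zero of `b * f + g` one has `g = -b * f`, so the new even part is `(z - b ^ 2) * f`,
  -- opposite in sign to `f`.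
  have h5 : b * g.eval z + z * f.eval z = (z - b ^ 2) * f.eval z := by linear_combination b * hF
  rw [h5, h4, pow_succ]
  have h6 : 0 < b ^ 2 - z := by nlinarith [sq_nonneg b]
  refine (mul_pos (mul_pos h6 ha) h3).trans_eq ?_
  ring

/-- At the zeros of `f` the new odd part equals `g`, hence alternates, and at `0` it equals `b *
f(0) > 0`; this yields `m` negative zeros. If `g` has degree `m + 1`, its sign near `-∞` yields one
more. The two degree alternatives are exchanged by the multiplication. -/
theorem HermiteBiehlerPair.mul_X_add_C {m : ℕ} {f g : ℝ[X]} (h : HermiteBiehlerPair m f g) {b : ℝ}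
    (hb : 0 < b) : ∃ m', HermiteBiehlerPair m' (C b * f + g) (C b * g + X * f) := by
  obtain ⟨a, ξ, ha, hξ, hξ0, hf, hg, hg0, hd⟩ := h
  have hfdeg : f.natDegree = m := by
    rw [hf, natDegree_C_mul ha.ne', natDegree_prod_range_X_sub_C]
  have hflc : f.leadingCoeff = a := by
    rw [hf, leadingCoeff_mul, leadingCoeff_C, (monic_prod_X_sub_C ξ m).leadingCoeff, mul_one]
  have hfne : f ≠ 0 := leadingCoeff_ne_zero.1 (hflc ▸ ha.ne')
  have hXf : (X * f).natDegree = m + 1 := by rw [natDegree_X_mul hfne, hfdeg]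
  have hXflc : (X * f).leadingCoeff = a := by rw [leadingCoeff_mul, leadingCoeff_X, one_mul, hflc]
  have hf0 : 0 < f.eval 0 := by
    have := eval_prod_pos_of_lt ξ 0 hξ0
    rw [hf, eval_mul, eval_C]
    positivity
  have hF0 : 0 < (C b * f + g).eval 0 := by
    simp only [eval_add, eval_mul, eval_C, hg0, add_zero]
    positivity
  have hFξ : ∀ i < m, (C b * f + g).eval (ξ i) = g.eval (ξ i) := by
    intro i hi
    simp [hf, eval_prod_range_X_sub_C_eq_zero ξ hi]
  have hG0 : (C b * g + X * f).eval 0 = 0 := by simp [hg0]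
  have hev : ∀ i ≤ m, 0 < (-1) ^ m * (-1) ^ i * (C b * f + g).eval (extendBy ξ m 0 i) := by
    intro i hi
    rw [← pow_add]
    rcases hi.eq_or_lt with rfl | hi
    · rw [extendBy_self, ← two_mul, pow_mul, neg_one_sq, one_pow, one_mul]
      exact hF0
    · rw [extendBy_of_lt hi, hFξ i hi]
      exact hg i hi
  have hlt : ∀ i ≤ m, extendBy ξ m 0 i ≤ 0 := by
    intro i hi
    rcases hi.eq_or_lt with rfl | hi
    · rw [extendBy_self]
    · rw [extendBy_of_lt hi]
      exact (hξ0 i hi).le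
  have hmono : ∀ i j, i ≤ j → j < m → ξ i ≤ ξ j := by
    intro i j hij hj
    rcases hij.eq_or_lt with rfl | hij
    · rfl
    · exact (lt_of_step_lt hξ hij hj).le
  have hroot : ∀ {k : ℕ} {c : ℝ} {ζ : ℕ → ℝ},
      C b * f + g = C c * ∏ i ∈ Finset.range k, (X - C (ζ i)) → ∀ i < k,
        (C b * f + g).eval (ζ i) = 0 := by
    intro k c ζ h i hi
    rw [h, eval_mul, eval_prod_range_X_sub_C_eq_zero ζ hi, mul_zero]
  have hlcpos : ∀ {k : ℕ} {c : ℝ} {ζ : ℕ → ℝ},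
      C b * f + g = C c * ∏ i ∈ Finset.range k, (X - C (ζ i)) → (∀ i < k, ζ i < 0) → 0 < c := by
    intro k c ζ h hζ
    rw [h, eval_mul, eval_C] at hF0
    exact pos_of_mul_pos_left hF0 (eval_prod_pos_of_lt ζ 0 hζ).le
  rcases hd with hd | ⟨hd, hlc⟩
  · have hFdeg : (C b * f + g).natDegree ≤ m :=
      natDegree_add_le_of_degree_le ((natDegree_C_mul_le _ _).trans hfdeg.le) hd
    have hlt' : (C b * g).natDegree < (X * f).natDegree := by
      have := natDegree_C_mul_le b g
      omega
    obtain ⟨ζ, hζ, hζs, -, hFe⟩ := exists_prod_of_alternating _ m hFdeg (extendBy ξ m 0)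
      (fun i hi => extendBy_step hξ hξ0 hi) _ hev
    have hζ0 : ∀ i < m, ζ i < 0 := fun i hi => (hζ i hi).2.trans_le (hlt _ hi)
    refine ⟨m, _, ζ, hlcpos hFe hζ0, hζs, hζ0, hFe, fun i hi => ?_, hG0, Or.inr ⟨?_, ?_⟩⟩
    · have := neg_one_pow_mul_eval_pos_of_eval_eq_zero (l := i + 1) hi ha hf (hζ0 i hi)
        (hroot hFe i hi) (fun j hj => ?_) (fun j hj hj' => ?_)
      · rw [show m + (i + 1) + 1 = m + i + 2 by omega, pow_add] at this
        simpa using this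
      · have := (hζ i hi).1
        rw [extendBy_of_lt hi] at this
        exact (hmono j i (by omega) hi).trans_lt this
      · have := (hζ i hi).2
        rw [extendBy_of_lt (by omega)] at this
        exact this.trans_le (hmono _ _ hj hj')
    · rw [natDegree_add_eq_right_of_natDegree_lt hlt', hXf]
    · rw [leadingCoeff_add_of_degree_lt (degree_lt_degree hlt'), hXflc]
      exact ha
  · have hlt' : (C b * f).natDegree < g.natDegree := by
      have := natDegree_C_mul_le b f
      omega
    have hFdeg : (C b * f + g).natDegree = m + 1 := by
      rw [natDegree_add_eq_right_of_natDegree_lt hlt', hd]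
    have hFlc : (C b * f + g).leadingCoeff = g.leadingCoeff :=
      leadingCoeff_add_of_degree_lt (degree_lt_degree hlt')
    -- A point far to the left starts the alternation one place earlier, giving the additional zero.
    obtain ⟨x, hx, hFx⟩ := exists_lt_neg_one_pow_mul_eval_pos (C b * f + g)
      (by omega) (by rw [hFlc]; exact hlc) (extendBy ξ m 0 0)
    obtain ⟨ζ, hζ, hζs, -, hFe⟩ := exists_prod_of_alternating _ (m + 1) hFdeg.le
      (fun i => Nat.casesOn i x (extendBy ξ m 0))
      (fun i hi => by
        rcases i with _ | i
        · exact hx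
        · exact extendBy_step hξ hξ0 (by omega)) ((-1) ^ (m + 1))
      (fun i hi => by
        rcases i with _ | i
        · simpa [hFdeg] using hFx
        · have := hev i (by omega)
          rw [show (-1 : ℝ) ^ m * (-1) ^ i = (-1) ^ (m + 1) * (-1) ^ (i + 1) by ring] at this
          exact this)
    have hζ0 : ∀ i < m + 1, ζ i < 0 := fun i hi => (hζ i hi).2.trans_le (hlt _ (by omega))
    refine ⟨m + 1, _, ζ, hlcpos hFe hζ0, hζs, hζ0, hFe, fun i hi => ?_, hG0, Or.inl ?_⟩
    · have := neg_one_pow_mul_eval_pos_of_eval_eq_zero (l := i) (by omega) ha hf (hζ0 i hi)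
        (hroot hFe i hi) (fun j hj => ?_) (fun j hj hj' => ?_)
      · rwa [show m + 1 + i = m + i + 1 by omega]
      · obtain ⟨i, rfl⟩ : ∃ i', i = i' + 1 := ⟨i - 1, by omega⟩
        have : extendBy ξ m 0 i < ζ (i + 1) := (hζ (i + 1) hi).1
        rw [extendBy_of_lt (by omega)] at this
        exact (hmono j i (by omega) (by omega)).trans_lt this
      · have : ζ i < extendBy ξ m 0 i := (hζ i hi).2
        rw [extendBy_of_lt (by omega)] at this
        exact this.trans_le (hmono _ _ hj hj')
    · exact natDegree_add_le_of_degree_le ((natDegree_C_mul_le _ _).trans hd.le) hXf.le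

theorem hermiteBiehlerPair_one_zero : HermiteBiehlerPair 0 1 0 :=
  ⟨1, fun _ => 0, one_pos, by simp, by simp, by simp, by simp, by simp, by simp⟩

theorem HermiteBiehlerPair.C_mul {m : ℕ} {f g : ℝ[X]} (h : HermiteBiehlerPair m f g) {c : ℝ}
    (hc : 0 < c) : HermiteBiehlerPair m (C c * f) (C c * g) := by
  obtain ⟨a, ξ, ha, hξ, hξ0, hf, hg, hg0, hd⟩ := h
  refine ⟨c * a, ξ, mul_pos hc ha, hξ, hξ0, by rw [hf, Polynomial.C_mul, mul_assoc], fun i hi => ?_,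
    by simp [hg0], ?_⟩
  · rw [eval_mul, eval_C, mul_left_comm]
    exact mul_pos hc (hg i hi)
  · rw [natDegree_C_mul hc.ne', leadingCoeff_mul, leadingCoeff_C]
    exact hd.imp_right fun h => ⟨h.1, mul_pos hc h.2⟩

/-! ### From sign alternation to interlacing zeros -/

theorem hasZeroList_of_eq_prod {p : ℝ[X]} {c : ℝ} (hc : c ≠ 0) {m : ℕ} {ξ : ℕ → ℝ}
    (hξ : ∀ i, i + 1 < m → ξ i < ξ (i + 1))
    (hp : p = C c * ∏ i ∈ Finset.range m, (X - C (ξ i))) :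
    HasZeroList p (fun i : Fin m => ξ i) := by
  have hlc : p.leadingCoeff = c := by
    rw [hp, leadingCoeff_mul, leadingCoeff_C, (monic_prod_X_sub_C ξ m).leadingCoeff, mul_one]
  refine ⟨leadingCoeff_ne_zero.1 (hlc ▸ hc), fun i j hij => ?_, ?_⟩
  · rcases hij.eq_or_lt with rfl | h
    · rfl
    · exact (lt_of_step_lt hξ h j.2).le
  · rw [hlc, Fin.prod_univ_eq_prod_range (fun i => (X : ℝ[X]) - C (ξ i)) m]
    exact hp

/-- Since `g(1) > 0`, the point `1` continues the alternation of `g` at the zeros of `f`. The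
resulting zeros of `g` interlace those of `f`, and the last one must be the known zero `0` because
the others are negative. Degree at most `m` gives `AlternatesLeft`, degree `m + 1` gives
`Interlaces`. -/
theorem HermiteBiehlerPair.prec {m : ℕ} {f g : ℝ[X]} (h : HermiteBiehlerPair m f g)
    (hg1 : 0 < g.eval 1) :
    Prec f g ∧ ∃ (N : ℕ) (c : ℝ) (θ : ℕ → ℝ), c ≠ 0 ∧ (∀ i, i + 1 < N + 1 → θ i < θ (i + 1)) ∧
      θ N = 0 ∧ g = C c * ∏ i ∈ Finset.range (N + 1), (X - C (θ i)) := by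
  obtain ⟨a, ξ, ha, hξ, hξ0, hf, hg, hg0, hd⟩ := h
  have hfz := hasZeroList_of_eq_prod ha.ne' hξ hf
  have hξ1 : ∀ i < m, ξ i < 1 := fun i hi => (hξ0 i hi).trans one_pos
  have hev : ∀ i ≤ m, 0 < (-1) ^ m * (-1) ^ i * g.eval (extendBy ξ m 1 i) := by
    intro i hi
    rw [← pow_add]
    rcases hi.eq_or_lt with rfl | hi
    · rw [extendBy_self, ← two_mul, pow_mul, neg_one_sq, one_pow, one_mul]
      exact hg1
    · rw [extendBy_of_lt hi]
      exact hg i hi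
  have hlast : ∀ {N : ℕ} {c : ℝ} {θ : ℕ → ℝ}, c ≠ 0 →
      g = C c * ∏ i ∈ Finset.range (N + 1), (X - C (θ i)) → (∀ i < N, θ i < 0) → θ N = 0 := by
    intro N c θ hc hge hθ
    rw [hge, eval_mul, eval_C, eval_prod, mul_eq_zero, Finset.prod_eq_zero_iff] at hg0
    obtain ⟨i, hi, hi0⟩ := hg0.resolve_left hc
    have hi0 : θ i = 0 := by simpa using hi0
    rcases Nat.lt_succ_iff_lt_or_eq.1 (Finset.mem_range.1 hi) with h | rfl
    · exact absurd hi0 (hθ i h).ne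
    · exact hi0
  rcases hd with hd | ⟨hd, hlc⟩
  -- For `m = 0` a constant `g` would contradict `g(0) = 0 < g(1)`.
  · obtain ⟨N, rfl⟩ : ∃ N, m = N + 1 := by
      rcases m with _ | N
      · rw [eq_C_of_natDegree_le_zero hd, eval_C] at hg0 hg1
        exact absurd hg0 hg1.ne'
      · exact ⟨N, rfl⟩
    obtain ⟨θ, hθ, hθs, hc, hge⟩ := exists_prod_of_alternating _ (N + 1) hd (extendBy ξ (N + 1) 1)
      (fun i hi => extendBy_step hξ hξ1 hi) _ hev
    refine ⟨Or.inr ⟨N + 1, _, _, hfz, hasZeroList_of_eq_prod hc hθs hge, fun i => ?_,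
      fun i j hij => ?_⟩, N, _, θ, hc, hθs, hlast hc hge fun i hi => ?_, hge⟩
    · have := (hθ i i.2).1
      rw [extendBy_of_lt i.2] at this
      exact this.le
    · have := (hθ i i.2).2
      rw [hij, extendBy_of_lt j.2] at this
      exact this.le
    · have := (hθ i (by omega)).2
      rw [extendBy_of_lt (by omega)] at this
      exact this.trans (hξ0 _ (by omega))
  · obtain ⟨x, hx, hgx⟩ := exists_lt_neg_one_pow_mul_eval_pos g
      (by omega) hlc (extendBy ξ m 1 0)
    obtain ⟨θ, hθ, hθs, hc, hge⟩ := exists_prod_of_alternating _ (m + 1) hd.le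
      (fun i => Nat.casesOn i x (extendBy ξ m 1))
      (fun i hi => by
        rcases i with _ | i
        · exact hx
        · exact extendBy_step hξ hξ1 (by omega)) ((-1) ^ (m + 1))
      (fun i hi => by
        rcases i with _ | i
        · simpa [hd] using hgx
        · have := hev i (by omega)
          rw [show (-1 : ℝ) ^ m * (-1) ^ i = (-1) ^ (m + 1) * (-1) ^ (i + 1) by ring] at this
          exact this)
    have hθξ : ∀ i < m, θ i < ξ i := by
      intro i hi
      have : θ i < extendBy ξ m 1 i := (hθ i (by omega)).2
      rwa [extendBy_of_lt hi] at this
    refine ⟨Or.inl ⟨m, _, _, hfz, hasZeroList_of_eq_prod hc hθs hge, fun i => ⟨?_, ?_⟩⟩,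
      m, _, θ, hc, hθs, hlast hc hge fun i hi => (hθξ i hi).trans (hξ0 i hi), hge⟩
    · exact (hθξ i i.2).le
    · have : extendBy ξ m 1 i < θ (i + 1) := (hθ (i + 1) (by have := i.2; omega)).1
      rw [extendBy_of_lt i.2] at this
      exact this.le

/-! ### The combined polynomial and its factorisation -/

/-- The generating polynomial of the up-down runs, with even part `TE` and odd part `TO`. -/
noncomputable def upDownPoly (n : ℕ) : ℝ[X] := expand ℝ 2 (TE n) + X * expand ℝ 2 (TO n)

theorem upDownPoly_succ {n : ℕ} (hn : 1 ≤ n) :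
    upDownPoly (n + 1) = X * (((n : ℝ[X]) * X + 1) * upDownPoly n
      + (1 - X ^ 2) * derivative (upDownPoly n)) := by
  simp only [upDownPoly, TE_succ hn, TO_succ hn, map_add, map_mul, map_sub, map_one, map_natCast,
    map_ofNat, expand_X, derivative_mul, derivative_X, derivative_expand]
  push_cast
  ring

theorem upDownPoly_one : upDownPoly 1 = X := by simp [upDownPoly, TE_one, TO_one]

theorem simpleZerosUpToZero_X : SimpleZerosUpToZero 0 X :=
  ⟨1, fun _ => 0, one_ne_zero, by simp, by simp, rfl, by simp⟩

theorem X_add_one_mul_derivative_pow (k : ℕ) :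
    (X + 1) * derivative ((X + 1 : ℝ[X]) ^ k) = (k : ℝ[X]) * (X + 1) ^ k := by
  rcases k with _ | k
  · simp
  · simp [derivative_pow]
    ring

/-- For `u = (X + 1) ^ j * p` the recurrence multiplies `p` by `n * X + 1 + j * (1 - X)`. With `n =
2 * k + 1`, `j = k` this is `(k + 1) * (X + 1)`, so a further factor `X + 1` splits off; with `n = 2
* k + 2`, `j = k + 1` it is `(k + 1) * X + (k + 2)` and the degree of the cofactor grows instead. -/
theorem exists_upDownPoly_eq (k : ℕ) :
    (∃ p, SimpleZerosUpToZero k p ∧ upDownPoly (2 * k + 1) = (X + 1) ^ k * p) ∧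
    (∃ p, SimpleZerosUpToZero k p ∧ upDownPoly (2 * k + 2) = (X + 1) ^ (k + 1) * p) := by
  have hodd : ∀ k, (∃ p, SimpleZerosUpToZero k p ∧ upDownPoly (2 * k + 1) = (X + 1) ^ k * p) →
      ∃ p, SimpleZerosUpToZero k p ∧ upDownPoly (2 * k + 2) = (X + 1) ^ (k + 1) * p := by
    rintro k ⟨p, hp, hu⟩
    refine ⟨_, simpleZerosUpToZero_one_sub hp, ?_⟩
    rw [upDownPoly_succ (by omega), hu, derivative_mul]
    push_cast
    linear_combination (X * (1 - X) * p) * X_add_one_mul_derivative_pow k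
  have heven : ∀ k,
      (∃ p, SimpleZerosUpToZero k p ∧ upDownPoly (2 * k + 2) = (X + 1) ^ (k + 1) * p) →
      ∃ p, SimpleZerosUpToZero (k + 1) p ∧
        upDownPoly (2 * (k + 1) + 1) = (X + 1) ^ (k + 1) * p := by
    rintro k ⟨p, hp, hu⟩
    refine ⟨_, simpleZerosUpToZero_one_sub_sq hp, ?_⟩
    rw [show 2 * (k + 1) + 1 = 2 * k + 2 + 1 by omega, upDownPoly_succ (by omega), hu,
      derivative_mul]
    have := X_add_one_mul_derivative_pow (k + 1)
    push_cast at this ⊢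
    linear_combination (X * (1 - X) * p) * this
  induction k with
  | zero =>
    have h0 : ∃ p, SimpleZerosUpToZero 0 p ∧ upDownPoly (2 * 0 + 1) = (X + 1) ^ 0 * p :=
      ⟨X, simpleZerosUpToZero_X, by rw [mul_zero, zero_add, upDownPoly_one, pow_zero, one_mul]⟩
    exact ⟨h0, hodd 0 h0⟩
  | succ k ih =>
    have h := heven k ih.2
    exact ⟨h, hodd _ h⟩

theorem eval_one_upDownPoly_pos {n : ℕ} (hn : 1 ≤ n) : 0 < (upDownPoly n).eval 1 := by
  induction n, hn using Nat.le_induction with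
  | base => simp [upDownPoly_one]
  | succ n hn ih =>
    rw [upDownPoly_succ hn]
    simp only [eval_mul, eval_add, eval_sub, eval_X, eval_natCast, eval_one, eval_pow]
    simp
    positivity

/-! ### Even and odd parts of the combined polynomial -/

/-- The even and odd parts of `u` form a Hermite–Biehler pair. -/
def HasHermiteBiehlerParts (u : ℝ[X]) : Prop :=
  ∃ (m : ℕ) (f g : ℝ[X]), HermiteBiehlerPair m f g ∧ u = expand ℝ 2 g + X * expand ℝ 2 f

theorem HasHermiteBiehlerParts.mul_X_add_C {u : ℝ[X]} (h : HasHermiteBiehlerParts u) {b : ℝ}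
    (hb : 0 < b) : HasHermiteBiehlerParts (u * (X + C b)) := by
  obtain ⟨m, f, g, hfg, rfl⟩ := h
  obtain ⟨m', h'⟩ := hfg.mul_X_add_C hb
  refine ⟨m', _, _, h', ?_⟩
  simp only [map_add, map_mul, expand_C, expand_X]
  ring

theorem HasHermiteBiehlerParts.C_mul {u : ℝ[X]} (h : HasHermiteBiehlerParts u) {c : ℝ}
    (hc : 0 < c) : HasHermiteBiehlerParts (C c * u) := by
  obtain ⟨m, f, g, hfg, rfl⟩ := h
  refine ⟨m, _, _, hfg.C_mul hc, ?_⟩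
  simp only [map_mul, expand_C]
  ring

theorem hasHermiteBiehlerParts_X : HasHermiteBiehlerParts X :=
  ⟨0, 1, 0, hermiteBiehlerPair_one_zero, by simp⟩

theorem HasHermiteBiehlerParts.mul_X_add_one_pow {u : ℝ[X]} (h : HasHermiteBiehlerParts u)
    (j : ℕ) : HasHermiteBiehlerParts (u * (X + 1) ^ j) := by
  induction j with
  | zero => simpa using h
  | succ j ih =>
    rw [pow_succ, ← mul_assoc]
    exact ih.mul_X_add_C one_pos

theorem HasHermiteBiehlerParts.mul_prod {u : ℝ[X]} (h : HasHermiteBiehlerParts u)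
    (r : ℕ → ℝ) (k : ℕ) (hr : ∀ i < k, r i < 0) :
    HasHermiteBiehlerParts (u * ∏ i ∈ Finset.range k, (X - C (r i))) := by
  induction k with
  | zero => simpa using h
  | succ k ih =>
    rw [Finset.prod_range_succ, ← mul_assoc, sub_eq_add_neg, ← C_neg]
    exact (ih fun i hi => hr i (by omega)).mul_X_add_C (neg_pos.2 (hr k (by omega)))

/-- The polynomial is built from `X` by factors `X + b` with `b > 0` and a constant; positivity at
`1` is what makes that constant positive. -/
theorem hasHermiteBiehlerParts_of_simpleZeros {k j : ℕ} {u p : ℝ[X]}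
    (hp : SimpleZerosUpToZero k p) (hu : u = (X + 1) ^ j * p) (h1 : 0 < u.eval 1) :
    HasHermiteBiehlerParts u := by
  obtain ⟨c, r, hc, hr, -, hr0, rfl⟩ := hp
  have hneg : ∀ i < k, r i < 0 := fun i hi => hr0 ▸ lt_of_step_lt hr hi (Nat.lt_succ_self k)
  have hu' : u = C c * (X * (X + 1) ^ j * ∏ i ∈ Finset.range k, (X - C (r i))) := by
    rw [hu, Finset.prod_range_succ, hr0, C_0]
    ring
  have hcpos : 0 < c := by
    have h2 := eval_prod_pos_of_lt r 1 (k := k) fun i hi => (hneg i hi).trans one_pos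
    rw [hu'] at h1
    simp only [eval_mul, eval_C, eval_X, eval_pow, eval_add, eval_one] at h1
    exact pos_of_mul_pos_left h1 (by positivity)
  rw [hu']
  exact ((hasHermiteBiehlerParts_X.mul_X_add_one_pow j).mul_prod r k hneg).C_mul hcpos

theorem expand_two_add_X_mul_injective {f g f' g' : ℝ[X]}
    (h : expand ℝ 2 g + X * expand ℝ 2 f = expand ℝ 2 g' + X * expand ℝ 2 f') :
    f = f' ∧ g = g' := by
  have hodd : ∀ (p : ℝ[X]) n, (expand ℝ 2 p).coeff (n * 2 + 1) = 0 := fun p n => by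
    rw [coeff_expand two_pos, if_neg (by omega)]
  have hev : ∀ (p : ℝ[X]) n, (X * expand ℝ 2 p).coeff (n * 2) = 0 := fun p n => by
    rcases n with _ | n
    · simp
    · rw [show (n + 1) * 2 = n * 2 + 1 + 1 by ring, coeff_X_mul, hodd]
  constructor <;> ext n
  · have := congrArg (fun p => p.coeff (n * 2 + 1)) h
    simpa only [coeff_add, hodd, coeff_X_mul, coeff_expand_mul two_pos, zero_add] using this
  · have := congrArg (fun p => p.coeff (n * 2)) h
    simpa only [coeff_add, hev, coeff_expand_mul two_pos, add_zero] using this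

theorem exists_hermiteBiehlerPair {n : ℕ} (hn : 1 ≤ n) :
    ∃ m, HermiteBiehlerPair m (TO n) (TE n) := by
  have h : HasHermiteBiehlerParts (upDownPoly n) := by
    obtain ⟨⟨p, hp, hu⟩, ⟨q, hq, hv⟩⟩ := exists_upDownPoly_eq ((n - 1) / 2)
    have h1 := eval_one_upDownPoly_pos hn
    rcases (show n = 2 * ((n - 1) / 2) + 1 ∨ n = 2 * ((n - 1) / 2) + 2 by omega) with h | h
    · rw [← h] at hu
      exact hasHermiteBiehlerParts_of_simpleZeros hp hu h1
    · rw [← h] at hv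
      exact hasHermiteBiehlerParts_of_simpleZeros hq hv h1
  obtain ⟨m, f, g, hfg, hu⟩ := h
  obtain ⟨rfl, rfl⟩ := expand_two_add_X_mul_injective hu
  exact ⟨m, hfg⟩

/-! ### Complex zeros, positivity at `1` and multiplicities -/

theorem exists_eq_of_aeval_prod_eq_zero {p : ℝ[X]} {c : ℝ} (hc : c ≠ 0) {m : ℕ} {r : ℕ → ℝ}
    (hp : p = C c * ∏ i ∈ Finset.range m, (X - C (r i))) {z : ℂ} (hz : aeval z p = 0) :
    ∃ i < m, z = (r i : ℂ) := by
  rw [hp, map_mul, map_prod, mul_eq_zero, Finset.prod_eq_zero_iff] at hz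
  rcases hz with hz | ⟨i, hi, hz⟩
  · simp [hc] at hz
  · refine ⟨i, Finset.mem_range.1 hi, sub_eq_zero.1 ?_⟩
    simpa using hz

theorem HermiteBiehlerPair.eval_one_pos {m : ℕ} {f g : ℝ[X]} (h : HermiteBiehlerPair m f g) :
    0 < f.eval 1 := by
  obtain ⟨a, ξ, ha, hξ, hξ0, hf, -⟩ := h
  rw [hf, eval_mul, eval_C]
  exact mul_pos ha (eval_prod_pos_of_lt ξ 1 fun i hi => (hξ0 i hi).trans one_pos)

theorem eval_one_TE_nonneg (n : ℕ) : 0 ≤ (TE n).eval 1 := by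
  rw [TE, eval_finsetSum]
  exact Finset.sum_nonneg fun π _ => by simp

/-- At `1` the derivative term of the recurrence vanishes, and the previous `TO` contributes a
positive value. For `n = 1` the claim fails, as `TE 1 = 0`. -/
theorem eval_one_TE_pos {n : ℕ} (hn : 2 ≤ n) : 0 < (TE n).eval 1 := by
  obtain ⟨k, rfl⟩ : ∃ k, n = k + 1 := ⟨n - 1, by omega⟩
  have hk : 1 ≤ k := by omega
  obtain ⟨m, hm⟩ := exists_hermiteBiehlerPair hk
  have h1 := hm.eval_one_pos
  have h2 := eval_one_TE_nonneg k
  rw [TE_succ hk]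
  simp
  positivity

theorem rootMultiplicity_of_eq_prod {p : ℝ[X]} {c : ℝ} (hc : c ≠ 0) {N i : ℕ} {θ : ℕ → ℝ}
    (hi : i < N) (hθ : ∀ i, i + 1 < N → θ i < θ (i + 1))
    (hp : p = C c * ∏ i ∈ Finset.range N, (X - C (θ i))) : p.rootMultiplicity (θ i) = 1 := by
  have hp0 : p ≠ 0 := by
    rw [hp]
    exact mul_ne_zero (C_ne_zero.2 hc) (monic_prod_X_sub_C θ N).ne_zero
  have h1 : 0 < p.rootMultiplicity (θ i) := by
    rw [rootMultiplicity_pos hp0, IsRoot, hp, eval_mul, eval_prod_range_X_sub_C_eq_zero θ hi,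
      mul_zero]
  have h2 : ¬ 1 < p.rootMultiplicity (θ i) := by
    rw [one_lt_rootMultiplicity_iff_isRoot hp0]
    rintro ⟨-, h⟩
    have h3 := neg_one_pow_mul_derivative_prod_pos θ hi hθ
    rw [IsRoot, hp, derivative_C_mul, eval_mul, eval_C] at h
    rw [(mul_eq_zero.1 h).resolve_left hc, mul_zero] at h3
    exact lt_irrefl _ h3
  omega

end UpDownRun

theorem mainTheorem4 :
    (UpDownRun.TE 1 = 0 ∧ UpDownRun.TO 1 = 1) ∧
    (∀ n : ℕ, 1 ≤ n →
      UpDownRun.TE (n + 1) =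
          (n : ℝ[X]) * X * UpDownRun.TE n
            + 2 * X * (1 - X) * derivative (UpDownRun.TE n) + X * UpDownRun.TO n ∧
      UpDownRun.TO (n + 1) =
          (((n : ℝ[X]) - 1) * X + 1) * UpDownRun.TO n
            + 2 * X * (1 - X) * derivative (UpDownRun.TO n) + UpDownRun.TE n) ∧
    (∀ n : ℕ, 1 ≤ n →
      ∀ z : ℂ, aeval z (UpDownRun.TO n) = 0 → ∃ r : ℝ, r < 0 ∧ z = (r : ℂ)) ∧
    (∀ n : ℕ, 2 ≤ n →
      (UpDownRun.TE n).rootMultiplicity 0 = 1 ∧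
      (∀ z : ℂ, aeval z (UpDownRun.TE n) = 0 → z = 0 ∨ ∃ r : ℝ, r < 0 ∧ z = (r : ℂ)) ∧
      UpDownRun.Prec (UpDownRun.TO n) (UpDownRun.TE n)) := by
  refine ⟨⟨UpDownRun.TE_one, UpDownRun.TO_one⟩,
    fun n hn => ⟨UpDownRun.TE_succ hn, UpDownRun.TO_succ hn⟩, fun n hn z hz => ?_,
    fun n hn => ?_⟩
  · obtain ⟨m, a, ξ, ha, -, hξ0, hf, -⟩ := UpDownRun.exists_hermiteBiehlerPair hn
    obtain ⟨i, hi, rfl⟩ := UpDownRun.exists_eq_of_aeval_prod_eq_zero ha.ne' hf hz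
    exact ⟨ξ i, hξ0 i hi, rfl⟩
  · obtain ⟨m, hm⟩ := UpDownRun.exists_hermiteBiehlerPair (n := n) (by omega)
    obtain ⟨hprec, N, c, θ, hc, hθ, hθ0, hg⟩ := hm.prec (UpDownRun.eval_one_TE_pos hn)
    refine ⟨?_, fun z hz => ?_, hprec⟩
    · rw [← hθ0]
      exact UpDownRun.rootMultiplicity_of_eq_prod hc (Nat.lt_succ_self N) hθ hg
    · obtain ⟨i, hi, rfl⟩ := UpDownRun.exists_eq_of_aeval_prod_eq_zero hc hg hz
      rcases Nat.lt_succ_iff_lt_or_eq.1 hi with h | rfl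
      · exact Or.inr ⟨θ i, hθ0 ▸ UpDownRun.lt_of_step_lt hθ h (Nat.lt_succ_self N), rfl⟩
      · exact Or.inl (by rw [hθ0]; rfl)
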